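/- Let $n\ge 1$, $d,N\ge 0$ be integers, let $\mathcal D$ be a probability distribution on a measurable space $\mathcal Z$, and let $S=(z_1,\dots,z_n)\sim\mathcal D^{n}$ be an i.i.d. training sample. Let $f(\cdot;z):\mathbb R^d\to\mathbb R$ ($z\in\mathcal Z$) be differentiable objective functions, let $R:\mathbb R^d\to\mathbb R$ be a differentiable regularizer (possibly $R=0$), and let $\ell:\mathbb R^d\times\mathcal Z\to\mathbb R$ be a loss function, with $\ell$ and $(\boldsymbol w,z)\mapsto\nabla f(\boldsymbol w;z)$ measurable. Let $\beta>0$, $\sigma_0>0$ and $\eta_1,\dots,\eta_N>0$. One-point Stochastic Gradient Langevin Dynamics (SGLD) on $S$ starts from $\boldsymbol w_0\sim\mathcal N(0,\sigma_0^2I_d)$ and performs, for $k=1,\dots,N$, $$\boldsymbol w_k=\boldsymbol w_{k-1}-\eta_k\bigl(\nabla f(\boldsymbol w_{k-1};z_{i_k})+\nabla R(\boldsymbol w_{k-1})\bigr)+\sqrt{\tfrac{2\eta_k}{\beta}}\,\xi_k ,$$ where $i_k\sim\mathcal U\{1,\dots,n\}$ and $\xi_k\sim\mathcal N(0,I_d)$,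 and $\boldsymbol w_0,i_1,\xi_1,i_2,\xi_2,\dots$ are mutually independent and independent of $S$. Denote by $\mathbb E_{\mathcal A}$ the expectation over this internal randomness of the algorithm with $S$ fixed, and put $$\mathrm{err}(\boldsymbol w_N)=\mathbb E_{\mathcal A}\Bigl(\mathbb E_{z\sim\mathcal D}\,\ell(\boldsymbol w_N;z)-\frac1n\sum_{j=1}^n\ell(\boldsymbol w_N;z_j)\Bigr).$$ Assume that 1. the loss is bounded by $C$: $0\le \ell(\boldsymbol w;z)\le C$ for all $\boldsymbol w\in\mathbb R^d$, $z\in\mathcal Z$; 2. $\|\nabla f(\boldsymbol w;z)-\nabla f(\boldsymbol w;z')\|\le L$ for all $\boldsymbol w\in\mathbb R^d$ and all $z,z'\in\mathcal Z$. Then, with the expectation taken over the training sample $S$, $$\mathbb E\bigl[\mathrm{err}(\boldsymbol w_N)\bigr]\le LC\left(\frac{\beta}{8n}\sum_{i=1}^N\eta_i\right)^{1/2}.$$ -/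

import Mathlib

open MeasureTheory ProbabilityTheory

noncomputable section

/-- One-point SGLD on the dataset `S`, driven by the initial point `w₀`, the indices `i 1, i 2, …`
of the training examples that are used, and the standard normal vectors `ξ 1, ξ 2, …`:
`w_k = w_{k-1} - η_k (∇f(w_{k-1}; z_{i_k}) + ∇R(w_{k-1})) + √(2 η_k / β) ξ_k`. -/
def sgldIterate {d n : ℕ} {Z : Type*}
    (f : EuclideanSpace ℝ (Fin d) → Z → ℝ) (R : EuclideanSpace ℝ (Fin d) → ℝ)
    (β : ℝ) (η : ℕ → ℝ) (S : Fin n → Z)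
    (w₀ : EuclideanSpace ℝ (Fin d)) (i : ℕ → Fin n) (ξ : ℕ → EuclideanSpace ℝ (Fin d)) :
    ℕ → EuclideanSpace ℝ (Fin d)
  | 0 => w₀
  | k + 1 =>
    let w := sgldIterate f R β η S w₀ i ξ k
    w - η (k + 1) • (gradient (fun v => f v (S (i (k + 1)))) w + gradient R w)
      + √(2 * η (k + 1) / β) • ξ (k + 1)

/-- The internal randomness of the algorithm: `W₀ ∼ N(0, σ₀² I_d)`, indices `I k` uniform on the
`n` positions, noise `ξ k ∼ N(0, I_d)`, all of these mutually independent. -/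
structure IsSGLDRandomness {d n : ℕ} {Ω : Type*} [MeasurableSpace Ω] (P : Measure Ω) (σ₀ : ℝ)
    (W₀ : Ω → EuclideanSpace ℝ (Fin d)) (I : ℕ → Ω → Fin n)
    (ξ : ℕ → Ω → EuclideanSpace ℝ (Fin d)) : Prop where
  measurable_init : Measurable W₀
  measurable_index : ∀ k, Measurable (I k)
  measurable_noise : ∀ k, Measurable (ξ k)
  law_init : P.map W₀ =
    (stdGaussian (EuclideanSpace ℝ (Fin d))).map (fun x => σ₀ • x)
  law_index : ∀ k, P.map (I k) = uniformOn (Set.univ : Set (Fin n))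
  law_noise : ∀ k, P.map (ξ k) = stdGaussian (EuclideanSpace ℝ (Fin d))
  indep_index_noise : ∀ k, IndepFun (I k) (ξ k) P
  indep_steps : iIndepFun (fun k ω => (I k ω, ξ k ω)) P
  indep_init : IndepFun W₀ (fun ω k => (I k ω, ξ k ω)) P

/-- Generalization error of the random output `w` of an algorithm run on the dataset `S`:
population loss minus empirical loss, averaged over the randomness `P` of the algorithm. -/
def genErr {d n : ℕ} {Z Ω : Type*} [MeasurableSpace Z] [MeasurableSpace Ω]
    (ℓ : EuclideanSpace ℝ (Fin d) → Z → ℝ) (D : Measure Z) (P : Measure Ω)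
    (S : Fin n → Z) (w : Ω → EuclideanSpace ℝ (Fin d)) : ℝ :=
  ∫ ω, ((∫ z, ℓ (w ω) z ∂D) - (1 / (n : ℝ)) * ∑ j, ℓ (w ω) (S j)) ∂P

end

/-! The generalization gap is controlled by stability in law: if two samples differ in one position,
the laws of `w_N` should have relative entropy at most `β L² / (4n) ∑ η`. Given the current point,
one step is a uniform mixture of Gaussians of covariance `(2η/β) I`. The two steps differ only for
the exceptional index, which has probability `1/n`. There the means are at most `η L` apart, so the
step costs at most `(1/n) (ηL)² / (2 · 2η/β) = β L² η / (4n)`.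

Entropy enters only through its dual form, `∫ φ dμ ≤ log ∫ exp φ dν + K` for bounded `φ`. This form
needs no densities, and the chain rule becomes an induction on the step in which the test function
is replaced by its log-Laplace transform under one step
(`IsSGLDRandomness.integral_le_log_integral_exp_sgldIterate`). Hoeffding's lemma then gives a
Pinsker bound for the expected loss (`integral_sub_integral_le_of_forall_mul_le`). Exchanging a
fresh test point with a training point transfers this to the generalization error
(`integral_integral_sub_integral_eval_le`). -/

open scoped RealInnerProductSpace

/-! ### Translations of the standard Gaussian (Cameron–Martin). -/

section Gaussian

variable {E : Type*} [NormedAddCommGroup E] [InnerProductSpace ℝ E] [FiniteDimensional ℝ E]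
  [MeasurableSpace E] [BorelSpace E]

/-- In an orthonormal basis the integral factors into one-dimensional complex moment generating
functions. Real and imaginary exponents are kept together because the characteristic function of the
tilted measure needs both. -/
lemma integral_cexp_inner_add_stdGaussian (θ t : E) :
    ∫ x, Complex.exp ((⟪x, θ⟫ : ℝ) + (⟪x, t⟫ : ℝ) * Complex.I) ∂(stdGaussian E)
      = Complex.exp ((‖θ‖ ^ 2 - ‖t‖ ^ 2 : ℝ) / 2 + (⟪θ, t⟫ : ℝ) * Complex.I) := by
  rw [stdGaussian, integral_map (Measurable.aemeasurable (by fun_prop))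
    (Measurable.aestronglyMeasurable (by fun_prop))]
  set b := stdOrthonormalBasis ℝ E
  have hprod : ∀ x : Fin (Module.finrank ℝ E) → ℝ,
      Complex.exp ((⟪∑ i, x i • b i, θ⟫ : ℝ) + (⟪∑ i, x i • b i, t⟫ : ℝ) * Complex.I)
        = ∏ i, Complex.exp (((⟪b i, θ⟫ : ℝ) + (⟪b i, t⟫ : ℝ) * Complex.I) * (x i : ℝ)) := by
    intro x
    rw [← Complex.exp_sum]
    congr 1
    simp only [sum_inner, real_inner_smul_left, Complex.ofReal_sum, Complex.ofReal_mul,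
      Finset.sum_mul]
    rw [← Finset.sum_add_distrib]
    exact Finset.sum_congr rfl fun i _ => by ring
  simp_rw [hprod]
  rw [integral_fintype_prod_eq_prod
    (f := fun i (y : ℝ) => Complex.exp (((⟪b i, θ⟫ : ℝ) + (⟪b i, t⟫ : ℝ) * Complex.I) * y))]
  have hone : ∀ i, ∫ y : ℝ, Complex.exp (((⟪b i, θ⟫ : ℝ) + (⟪b i, t⟫ : ℝ) * Complex.I) * y)
      ∂(gaussianReal 0 1)
        = Complex.exp ((((⟪b i, θ⟫ : ℝ) + (⟪b i, t⟫ : ℝ) * Complex.I) : ℂ) ^ 2 / 2) := by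
    intro i
    have := complexMGF_id_gaussianReal (μ := 0) (v := 1)
      (((⟪b i, θ⟫ : ℝ) + (⟪b i, t⟫ : ℝ) * Complex.I) : ℂ)
    simpa [complexMGF] using this
  simp_rw [hone]
  rw [← Complex.exp_sum]
  congr 1
  have h1 : ‖θ‖ ^ 2 = ∑ i, ⟪b i, θ⟫ ^ 2 := (b.sum_sq_inner_right θ).symm
  have h2 : ‖t‖ ^ 2 = ∑ i, ⟪b i, t⟫ ^ 2 := (b.sum_sq_inner_right t).symm
  have h3 : ⟪θ, t⟫ = ∑ i, ⟪b i, θ⟫ * ⟪b i, t⟫ := by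
    rw [← b.sum_inner_mul_inner θ t]
    exact Finset.sum_congr rfl fun i _ => by rw [real_inner_comm]
  rw [h1, h2, h3]
  push_cast
  rw [← Finset.sum_sub_distrib, Finset.sum_div, Finset.sum_mul, ← Finset.sum_add_distrib]
  refine Finset.sum_congr rfl fun i _ => ?_
  linear_combination ((⟪b i, t⟫ : ℝ) : ℂ) ^ 2 / 2 * Complex.I_sq

lemma integral_exp_inner_stdGaussian (θ : E) :
    ∫ x, Real.exp ⟪x, θ⟫ ∂(stdGaussian E) = Real.exp (‖θ‖ ^ 2 / 2) := by
  have h := integral_cexp_inner_add_stdGaussian θ 0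
  apply Complex.ofReal_injective
  rw [← integral_complex_ofReal]
  simpa using h

lemma integrable_exp_inner_stdGaussian (θ : E) :
    Integrable (fun x => Real.exp ⟪x, θ⟫) (stdGaussian E) := by
  -- The Bochner integral of a non-integrable function is zero by convention, so a nonzero value
  -- proves integrability.
  refine .of_integral_ne_zero ?_
  rw [integral_exp_inner_stdGaussian]
  positivity

/-- Exponential tilting of the standard Gaussian measure is a translation. -/
lemma tilted_inner_stdGaussian (θ : E) :
    (stdGaussian E).tilted (fun x => ⟪x, θ⟫) = (stdGaussian E).map (fun x => x + θ) := by
  have := isProbabilityMeasure_tilted (integrable_exp_inner_stdGaussian θ)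
  have : IsProbabilityMeasure ((stdGaussian E).map (fun x => x + θ)) :=
    Measure.isProbabilityMeasure_map (by fun_prop)
  refine Measure.ext_of_charFun ?_
  ext t
  rw [charFun_apply, charFun_apply, integral_map (by fun_prop)
    (Measurable.aestronglyMeasurable (by fun_prop)), integral_tilted,
    integral_exp_inner_stdGaussian]
  have h1 : ∀ x : E, (Real.exp ⟪x, θ⟫ / Real.exp (‖θ‖ ^ 2 / 2))
      • Complex.exp ((⟪x, t⟫ : ℝ) * Complex.I)
      = Complex.exp (-(‖θ‖ ^ 2 / 2 : ℝ))
        * Complex.exp ((⟪x, θ⟫ : ℝ) + (⟪x, t⟫ : ℝ) * Complex.I) := by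
    intro x
    rw [← Real.exp_sub, Complex.real_smul, Complex.ofReal_exp, ← Complex.exp_add,
      ← Complex.exp_add]
    push_cast
    ring_nf
  have h2 : ∀ x : E, Complex.exp ((⟪x + θ, t⟫ : ℝ) * Complex.I)
      = Complex.exp ((⟪θ, t⟫ : ℝ) * Complex.I) * Complex.exp ((⟪x, t⟫ : ℝ) * Complex.I) := by
    intro x
    rw [← Complex.exp_add, inner_add_left]
    push_cast
    ring_nf
  simp_rw [h1, h2]
  rw [integral_const_mul, integral_const_mul, integral_cexp_inner_add_stdGaussian,
    ← charFun_apply, charFun_stdGaussian, ← Complex.exp_add, ← Complex.exp_add]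
  push_cast
  ring_nf

lemma integral_add_right_stdGaussian (θ : E) {h : E → ℝ} (hh : Measurable h) :
    ∫ x, h (x + θ) ∂(stdGaussian E)
      = ∫ x, Real.exp (⟪x, θ⟫ - ‖θ‖ ^ 2 / 2) * h x ∂(stdGaussian E) := by
  rw [← integral_map (φ := fun x => x + θ) (by fun_prop) hh.aestronglyMeasurable,
    ← tilted_inner_stdGaussian, integral_tilted, integral_exp_inner_stdGaussian]
  simp_rw [Real.exp_sub, smul_eq_mul]

end Gaussian

/-! ### Log-Laplace transforms, the dual entropy bound and a Pinsker inequality. -/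

/-- Jensen's inequality for the exponential, in logarithmic form. -/
lemma integral_le_log_integral_exp {α : Type*} [MeasurableSpace α] {μ : Measure α}
    [IsProbabilityMeasure μ] {g : α → ℝ} (hg : Integrable g μ)
    (hexp : Integrable (fun x => Real.exp (g x)) μ) :
    ∫ x, g x ∂μ ≤ Real.log (∫ x, Real.exp (g x) ∂μ) := by
  have h := convexOn_exp.map_integral_le Real.continuous_exp.continuousOn isClosed_univ
    (by simp) hg hexp
  exact (Real.le_log_iff_exp_le ((Real.exp_pos _).trans_le h)).2 h

lemma integrable_of_measurable_of_abs_le {α : Type*} [MeasurableSpace α] {μ : Measure α}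
    [IsFiniteMeasure μ] {g : α → ℝ} (hg : Measurable g) {B : ℝ} (hB : ∀ x, |g x| ≤ B) :
    Integrable g μ :=
  .of_bound hg.aestronglyMeasurable B (.of_forall hB)

lemma integrable_exp_of_measurable_of_abs_le {α : Type*} [MeasurableSpace α] {μ : Measure α}
    [IsFiniteMeasure μ] {g : α → ℝ} (hg : Measurable g) {B : ℝ} (hB : ∀ x, |g x| ≤ B) :
    Integrable (fun x => Real.exp (g x)) μ :=
  integrable_of_measurable_of_abs_le (B := Real.exp B) (by fun_prop) fun x => by
    rw [Real.abs_exp]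
    exact Real.exp_le_exp.2 ((le_abs_self _).trans (hB x))

/-- Log-Laplace transforms keep the sup bound, so they are again admissible test functions in the
induction on steps. -/
lemma abs_log_integral_exp_le {α : Type*} [MeasurableSpace α] {μ : Measure α}
    [IsProbabilityMeasure μ] {g : α → ℝ} (hg : Measurable g) {B : ℝ} (hB : ∀ x, |g x| ≤ B) :
    |Real.log (∫ x, Real.exp (g x) ∂μ)| ≤ B := by
  have hi := integrable_exp_of_measurable_of_abs_le (μ := μ) hg hB
  have h1 : Real.exp (-B) ≤ ∫ x, Real.exp (g x) ∂μ := by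
    simpa using integral_mono (integrable_const (Real.exp (-B))) hi
      fun x => Real.exp_le_exp.2 (abs_le.1 (hB x)).1
  have h2 : ∫ x, Real.exp (g x) ∂μ ≤ Real.exp B := by
    simpa using integral_mono hi (integrable_const (Real.exp B))
      fun x => Real.exp_le_exp.2 (abs_le.1 (hB x)).2
  have hpos := (Real.exp_pos _).trans_le h1
  exact abs_le.2 ⟨(Real.le_log_iff_exp_le hpos).2 h1, (Real.log_le_iff_le_exp hpos).2 h2⟩

/-- The error term is the relative entropy of two Gaussians with common covariance `s² I`. Moving
the mean from `a` to `a'` inserts the density `exp (⟪x, θ⟫ - ‖θ‖² / 2)` under the logarithm. In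
Jensen's inequality the linear term then averages to zero, leaving only `-‖θ‖² / 2`. -/
lemma integral_gaussian_le_log_integral_exp {E : Type*} [NormedAddCommGroup E]
    [InnerProductSpace ℝ E] [FiniteDimensional ℝ E] [MeasurableSpace E] [BorelSpace E]
    {φ : E → ℝ} (hφ : Measurable φ) {B : ℝ} (hB : ∀ x, |φ x| ≤ B) (a a' : E) {s : ℝ}
    (hs : 0 < s) :
    ∫ x, φ (a + s • x) ∂(stdGaussian E)
      ≤ Real.log (∫ x, Real.exp (φ (a' + s • x)) ∂(stdGaussian E))
        + ‖a' - a‖ ^ 2 / (2 * s ^ 2) := by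
  set θ : E := s⁻¹ • (a' - a) with hθ
  have hshift : ∀ x : E, a' + s • x = a + s • (x + θ) := by
    intro x
    rw [smul_add, hθ, smul_inv_smul₀ hs.ne']
    abel
  have hnorm : ‖θ‖ ^ 2 / 2 = ‖a' - a‖ ^ 2 / (2 * s ^ 2) := by
    rw [hθ, norm_smul, Real.norm_of_nonneg (by positivity)]
    field_simp
  have hm : Measurable fun x : E => φ (a + s • x) := by fun_prop
  have hφi : Integrable (fun x => φ (a + s • x)) (stdGaussian E) :=
    integrable_of_measurable_of_abs_le hm fun x => hB _
  have hlin : Integrable (fun x : E => ⟪x, θ⟫) (stdGaussian E) := by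
    simpa [real_inner_comm] using
      (IsGaussian.integrable_id (μ := stdGaussian E)).const_inner (𝕜 := ℝ) θ
  have hlin0 : ∫ x, ⟪x, θ⟫ ∂(stdGaussian E) = 0 := by
    have := integral_strongDual_stdGaussian (innerSL ℝ θ)
    simpa [real_inner_comm] using this
  have hg : Integrable (fun x => ⟪x, θ⟫ - ‖θ‖ ^ 2 / 2 + φ (a + s • x)) (stdGaussian E) :=
    (hlin.sub (integrable_const _)).add hφi
  have hexp : Integrable (fun x => Real.exp (⟪x, θ⟫ - ‖θ‖ ^ 2 / 2 + φ (a + s • x)))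
      (stdGaussian E) := by
    have h1 := (integrable_exp_inner_stdGaussian θ).mul_const (Real.exp (-(‖θ‖ ^ 2 / 2)))
    refine (h1.mul_bdd (c := Real.exp B) (g := fun x => Real.exp (φ (a + s • x)))
      (Measurable.aestronglyMeasurable (by fun_prop)) (.of_forall fun x => ?_)).congr (.of_forall fun x => ?_)
    · rw [Real.norm_eq_abs, Real.abs_exp]
      exact Real.exp_le_exp.2 ((le_abs_self _).trans (hB _))
    · simp only [← Real.exp_add, sub_eq_add_neg]
  have hJ := integral_le_log_integral_exp hg hexp
  rw [integral_add (f := fun x => ⟪x, θ⟫ - ‖θ‖ ^ 2 / 2) (hlin.sub (integrable_const _)) hφi,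
    integral_sub hlin (integrable_const _), hlin0] at hJ
  have hrw : ∫ x, Real.exp (φ (a' + s • x)) ∂(stdGaussian E)
      = ∫ x, Real.exp (⟪x, θ⟫ - ‖θ‖ ^ 2 / 2 + φ (a + s • x)) ∂(stdGaussian E) := by
    simp_rw [hshift]
    rw [integral_add_right_stdGaussian θ (h := fun x => Real.exp (φ (a + s • x))) (by fun_prop)]
    simp_rw [← Real.exp_add]
  rw [hrw, ← hnorm]
  simp at hJ
  linarith

/-- A Pinsker-type bound: if `∫ φ dμ ≤ log ∫ exp φ dν + K` for the multiples of `g`, then the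
means of `g` under `μ` and `ν` are close. -/
lemma integral_sub_integral_le_of_forall_mul_le {α : Type*} [MeasurableSpace α] {μ ν : Measure α}
    [IsProbabilityMeasure ν] {g : α → ℝ} (hg : Measurable g) {C K : ℝ}
    (hC : 0 ≤ C) (hg0 : ∀ x, 0 ≤ g x) (hgC : ∀ x, g x ≤ C)
    (h : ∀ t : ℝ, ∫ x, t * g x ∂μ ≤ Real.log (∫ x, Real.exp (t * g x) ∂ν) + K) :
    ∫ x, g x ∂μ - ∫ x, g x ∂ν ≤ C * √(K / 2) := by
  set D := ∫ x, g x ∂μ - ∫ x, g x ∂ν with hD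
  -- Hoeffding's lemma: the variance proxy is `(C / 2)²`, whence `t² C² / 8` below.
  have hsub := hasSubgaussianMGF_of_mem_Icc (μ := ν) (X := g) (a := 0) (b := C)
    hg.aemeasurable (.of_forall fun x => ⟨hg0 x, hgC x⟩)
  have hlog : ∀ t : ℝ, Real.log (∫ x, Real.exp (t * g x) ∂ν)
      ≤ t * ∫ x, g x ∂ν + t ^ 2 * C ^ 2 / 8 := by
    intro t
    have h1 := hsub.mgf_le t
    have h2 : mgf (fun ω => g ω - ∫ x, g x ∂ν) ν t
        = Real.exp (-(t * ∫ x, g x ∂ν)) * ∫ x, Real.exp (t * g x) ∂ν := by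
      rw [mgf, ← integral_const_mul]
      refine integral_congr_ae (.of_forall fun x => ?_)
      simp only [← Real.exp_add]
      ring_nf
    have h3 : (0 : ℝ) < ∫ x, Real.exp (t * g x) ∂ν := by
      refine integral_exp_pos (integrable_exp_of_measurable_of_abs_le (B := |t| * C)
        (by fun_prop) fun x => ?_)
      rw [abs_mul, abs_of_nonneg (hg0 x)]
      exact mul_le_mul_of_nonneg_left (hgC x) (abs_nonneg _)
    rw [h2] at h1
    have h4 := Real.log_le_log (by positivity) h1
    rw [Real.log_mul (Real.exp_pos _).ne' h3.ne', Real.log_exp, Real.log_exp] at h4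
    simp [abs_of_nonneg hC] at h4
    linarith
  have hquad : ∀ t : ℝ, t * D ≤ t ^ 2 * C ^ 2 / 8 + K := by
    intro t
    have h1 := h t
    rw [integral_const_mul] at h1
    have h2 := hlog t
    rw [hD, mul_sub]
    linarith
  -- Nonnegativity for every `t` replaces optimizing over `t` and also covers `C = 0`; the
  -- discriminant gives `D² ≤ C² K / 2`.
  have hdisc := discrim_le_zero (a := C ^ 2 / 8) (b := -D) (c := K) fun t => by
    linarith [hquad t]
  rw [discrim] at hdisc
  calc D ≤ √(C ^ 2 * (K / 2)) := Real.le_sqrt_of_sq_le (by linarith)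
    _ = C * √(K / 2) := by rw [Real.sqrt_mul (by positivity), Real.sqrt_sq hC]

/-! ### Causality and measurability of the SGLD recursion. -/

section Iterates

variable {d n : ℕ} {Z : Type*}
  {f : EuclideanSpace ℝ (Fin d) → Z → ℝ} {R : EuclideanSpace ℝ (Fin d) → ℝ}

lemma sgldIterate_congr {β : ℝ} {η : ℕ → ℝ} {S : Fin n → Z} {w₀ : EuclideanSpace ℝ (Fin d)}
    {i i' : ℕ → Fin n} {ξ ξ' : ℕ → EuclideanSpace ℝ (Fin d)} {k : ℕ}
    (hi : ∀ j ≤ k, i j = i' j) (hξ : ∀ j ≤ k, ξ j = ξ' j) :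
    sgldIterate f R β η S w₀ i ξ k = sgldIterate f R β η S w₀ i' ξ' k := by
  induction k with
  | zero => rfl
  | succ k ih =>
    simp only [sgldIterate]
    rw [ih (fun j hj => hi j (by omega)) (fun j hj => hξ j (by omega)), hi _ le_rfl, hξ _ le_rfl]

lemma measurable_gradient {E : Type*} [NormedAddCommGroup E] [InnerProductSpace ℝ E]
    [CompleteSpace E] [MeasurableSpace E] [BorelSpace E] (g : E → ℝ) :
    Measurable (gradient g) :=
  (InnerProductSpace.toDual ℝ E).symm.continuous.measurable.comp (measurable_fderiv ℝ g)

/-- The noiseless part of one SGLD step. -/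
noncomputable def sgldDrift (f : EuclideanSpace ℝ (Fin d) → Z → ℝ) (R : EuclideanSpace ℝ (Fin d) → ℝ)
    (h : ℝ) (S : Fin n → Z) (w : EuclideanSpace ℝ (Fin d)) (j : Fin n) :
    EuclideanSpace ℝ (Fin d) :=
  w - h • (gradient (fun v => f v (S j)) w + gradient R w)

lemma sgldIterate_succ (β : ℝ) (η : ℕ → ℝ) (S : Fin n → Z) (w₀ : EuclideanSpace ℝ (Fin d))
    (i : ℕ → Fin n) (ξ : ℕ → EuclideanSpace ℝ (Fin d)) (k : ℕ) :
    sgldIterate f R β η S w₀ i ξ (k + 1)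
      = sgldDrift f R (η (k + 1)) S (sgldIterate f R β η S w₀ i ξ k) (i (k + 1))
        + √(2 * η (k + 1) / β) • ξ (k + 1) :=
  rfl

lemma Measurable.sgldDrift [MeasurableSpace Z]
    (hf : Measurable fun p : EuclideanSpace ℝ (Fin d) × Z => gradient (fun w => f w p.2) p.1)
    {A : Type*} [MeasurableSpace A] {S : A → Fin n → Z} {w : A → EuclideanSpace ℝ (Fin d)}
    {j : A → Fin n} (hS : Measurable S) (hw : Measurable w) (hj : Measurable j) (h : ℝ) :
    Measurable fun a => sgldDrift f R h (S a) (w a) (j a) := by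
  have heval : Measurable fun p : (Fin n → Z) × Fin n => p.1 p.2 :=
    measurable_from_prod_countable_left fun i => measurable_pi_apply i
  have h1 : Measurable fun a => gradient (fun v => f v (S a (j a))) (w a) :=
    hf.comp (hw.prodMk (heval.comp (hS.prodMk hj)))
  have h2 : Measurable fun a => gradient R (w a) := (measurable_gradient R).comp hw
  exact hw.sub ((h1.add h2).const_smul h)

lemma Measurable.sgldIterate [MeasurableSpace Z]
    (hf : Measurable fun p : EuclideanSpace ℝ (Fin d) × Z => gradient (fun w => f w p.2) p.1)
    {A : Type*} [MeasurableSpace A] {S : A → Fin n → Z} {w₀ : A → EuclideanSpace ℝ (Fin d)}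
    {i : A → ℕ → Fin n} {ξ : A → ℕ → EuclideanSpace ℝ (Fin d)} (hS : Measurable S)
    (hw₀ : Measurable w₀) (hi : ∀ k, Measurable fun a => i a k)
    (hξ : ∀ k, Measurable fun a => ξ a k) (β : ℝ) (η : ℕ → ℝ) (k : ℕ) :
    Measurable fun a => sgldIterate f R β η (S a) (w₀ a) (i a) (ξ a) k := by
  induction k with
  | zero => exact hw₀
  | succ k ih =>
    simp only [sgldIterate_succ]
    exact (Measurable.sgldDrift hf hS ih (hi _) _).add ((hξ _).const_smul (√(2 * η (k + 1) / β)))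

end Iterates

/-! ### Independence and the Markov property of the iterates. -/

lemma ProbabilityTheory.IndepFun.prodMk_left_of_prodMk_right {Ω α β γ : Type*}
    [MeasurableSpace Ω] [MeasurableSpace α] [MeasurableSpace β] [MeasurableSpace γ]
    {P : Measure Ω} [IsProbabilityMeasure P] {X : Ω → α} {Y : Ω → β} {U : Ω → γ}
    (hX : Measurable X) (hY : Measurable Y) (hU : Measurable U)
    (h : IndepFun X (fun ω => (Y ω, U ω)) P) (hYU : IndepFun Y U P) :
    IndepFun (fun ω => (X ω, Y ω)) U P := by
  have := Measure.isProbabilityMeasure_map (μ := P) hX.aemeasurable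
  have := Measure.isProbabilityMeasure_map (μ := P) hY.aemeasurable
  have := Measure.isProbabilityMeasure_map (μ := P) hU.aemeasurable
  have hXY : IndepFun X Y P := h.comp measurable_id measurable_fst
  rw [indepFun_iff_map_prod_eq_prod_map_map (by fun_prop) (by fun_prop)] at *
  rw [hXY]
  rw [hYU] at h
  rw [← (measurePreserving_prodAssoc (P.map X) (P.map Y) (P.map U)).symm.map_eq, ← h,
    Measure.map_map (by fun_prop) (by fun_prop)]
  rfl

section Randomness

variable {d n : ℕ} {Z Ω : Type*} [MeasurableSpace Z] [MeasurableSpace Ω]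
  {f : EuclideanSpace ℝ (Fin d) → Z → ℝ} {R : EuclideanSpace ℝ (Fin d) → ℝ}
  {P : Measure Ω} {σ₀ : ℝ}
  {W₀ : Ω → EuclideanSpace ℝ (Fin d)} {I : ℕ → Ω → Fin n}
  {ξ : ℕ → Ω → EuclideanSpace ℝ (Fin d)}

lemma IsSGLDRandomness.measurable_sgldIterate (hrand : IsSGLDRandomness P σ₀ W₀ I ξ)
    (hf : Measurable fun p : EuclideanSpace ℝ (Fin d) × Z => gradient (fun w => f w p.2) p.1)
    (β : ℝ) (η : ℕ → ℝ) (S : Fin n → Z) (k : ℕ) :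
    Measurable fun ω => sgldIterate f R β η S (W₀ ω) (fun k => I k ω) (fun k => ξ k ω) k :=
  Measurable.sgldIterate hf measurable_const hrand.measurable_init hrand.measurable_index
    hrand.measurable_noise β η k

/-- The iterate is a measurable function of `W₀` and finitely many past steps, and these are jointly
independent of the next step. -/
lemma IsSGLDRandomness.indepFun_sgldIterate [IsProbabilityMeasure P]
    (hrand : IsSGLDRandomness P σ₀ W₀ I ξ)
    (hf : Measurable fun p : EuclideanSpace ℝ (Fin d) × Z => gradient (fun w => f w p.2) p.1)
    (β : ℝ) (η : ℕ → ℝ) (S : Fin n → Z) (k : ℕ) :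
    IndepFun (fun ω => sgldIterate f R β η S (W₀ ω) (fun k => I k ω) (fun k => ξ k ω) k)
      (fun ω => (I (k + 1) ω, ξ (k + 1) ω)) P := by
  set X : ℕ → Ω → Fin n × EuclideanSpace ℝ (Fin d) := fun j ω => (I j ω, ξ j ω) with hXdef
  have hX : ∀ j, Measurable (X j) := fun j =>
    (hrand.measurable_index j).prodMk (hrand.measurable_noise j)
  let past : Finset ℕ := Finset.range (k + 1)
  let Y : Ω → past → Fin n × EuclideanSpace ℝ (Fin d) := fun ω j => X j ω
  have hY : Measurable Y := measurable_pi_lambda _ fun j => hX j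
  have hYX : IndepFun Y (X (k + 1)) P := by
    have := hrand.indep_steps.indepFun_finset past {k + 1} (by simp [past]) hX
    exact this.comp measurable_id
      (measurable_pi_apply (⟨k + 1, by simp⟩ : ({k + 1} : Finset ℕ)))
  have hW : IndepFun W₀ (fun ω => (Y ω, X (k + 1) ω)) P :=
    hrand.indep_init.comp (ψ := fun x : ℕ → Fin n × EuclideanSpace ℝ (Fin d) =>
      ((fun j : past => x j), x (k + 1))) measurable_id (by fun_prop)
  have hindep := IndepFun.prodMk_left_of_prodMk_right hrand.measurable_init hY (hX _) hW hYX
  -- The recursion takes infinite sequences, so the finite past is padded. The filler is immaterial: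
  -- iterate `k` does not look beyond index `k`.
  let ext : (past → Fin n × EuclideanSpace ℝ (Fin d)) → ℕ → Fin n × EuclideanSpace ℝ (Fin d) :=
    fun y j => if h : j ∈ past then y ⟨j, h⟩ else y ⟨0, by simp [past]⟩
  have hext : ∀ j, Measurable fun y => ext y j := by
    intro j
    by_cases h : j ∈ past
    · simpa only [ext, h, dite_true] using measurable_pi_apply _
    · simpa only [ext, h, dite_false] using measurable_pi_apply _
  have hG : Measurable fun p : EuclideanSpace ℝ (Fin d) ×
      (past → Fin n × EuclideanSpace ℝ (Fin d)) =>
      sgldIterate f R β η S p.1 (fun j => (ext p.2 j).1) (fun j => (ext p.2 j).2) k :=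
    Measurable.sgldIterate hf measurable_const measurable_fst
      (fun j => ((hext j).comp measurable_snd).fst) (fun j => ((hext j).comp measurable_snd).snd)
      β η k
  have hcomp := hindep.comp hG measurable_id
  have hval : ∀ ω, ∀ j ≤ k, ext (Y ω) j = X j ω := by
    intro ω j hj
    have : j ∈ past := by simp [past]; omega
    simp [ext, this, Y]
  convert! hcomp using 1
  ext1 ω
  exact sgldIterate_congr (fun j hj => by simp [hval ω j hj, hXdef])
    fun j hj => by simp [hval ω j hj, hXdef]

/-- The Markov property: by independence the next index and noise can be integrated out with the
current iterate frozen. -/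
lemma IsSGLDRandomness.integral_sgldIterate_succ [IsProbabilityMeasure P] (hn : 0 < n)
    (hrand : IsSGLDRandomness P σ₀ W₀ I ξ)
    (hf : Measurable fun p : EuclideanSpace ℝ (Fin d) × Z => gradient (fun w => f w p.2) p.1)
    (β : ℝ) (η : ℕ → ℝ) (S : Fin n → Z) (k : ℕ)
    {φ : EuclideanSpace ℝ (Fin d) → ℝ} (hφ : Measurable φ) {B : ℝ} (hB : ∀ x, |φ x| ≤ B) :
    ∫ ω, φ (sgldIterate f R β η S (W₀ ω) (fun k => I k ω) (fun k => ξ k ω) (k + 1)) ∂P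
      = ∫ ω, (∫ j, ∫ x, φ (sgldDrift f R (η (k + 1)) S
          (sgldIterate f R β η S (W₀ ω) (fun k => I k ω) (fun k => ξ k ω) k) j
          + √(2 * η (k + 1) / β) • x) ∂(stdGaussian (EuclideanSpace ℝ (Fin d)))
          ∂(uniformOn (Set.univ : Set (Fin n)))) ∂P := by
  have : Nonempty (Fin n) := ⟨⟨0, hn⟩⟩
  have : IsProbabilityMeasure (uniformOn (Set.univ : Set (Fin n))) :=
    isProbabilityMeasure_uniformOn Set.finite_univ Set.univ_nonempty
  set w : Ω → EuclideanSpace ℝ (Fin d) :=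
    fun ω => sgldIterate f R β η S (W₀ ω) (fun k => I k ω) (fun k => ξ k ω) k
  have hwm : Measurable w := hrand.measurable_sgldIterate hf β η S k
  have hI := hrand.measurable_index (k + 1)
  have hξ := hrand.measurable_noise (k + 1)
  have := Measure.isProbabilityMeasure_map (μ := P) hwm.aemeasurable
  have hstep : P.map (fun ω => (I (k + 1) ω, ξ (k + 1) ω))
      = (uniformOn (Set.univ : Set (Fin n))).prod (stdGaussian (EuclideanSpace ℝ (Fin d))) := by
    rw [← hrand.law_index (k + 1), ← hrand.law_noise (k + 1)]
    exact (indepFun_iff_map_prod_eq_prod_map_map hI.aemeasurable hξ.aemeasurable).1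
      (hrand.indep_index_noise (k + 1))
  have hjoint := (indepFun_iff_map_prod_eq_prod_map_map hwm.aemeasurable
    (hI.prodMk hξ).aemeasurable).1 (hrand.indepFun_sgldIterate (R := R) hf β η S k)
  rw [hstep] at hjoint
  set g : EuclideanSpace ℝ (Fin d) × Fin n × EuclideanSpace ℝ (Fin d) → ℝ := fun p =>
    φ (sgldDrift f R (η (k + 1)) S p.1 p.2.1 + √(2 * η (k + 1) / β) • p.2.2)
  have hgm : Measurable g := hφ.comp ((Measurable.sgldDrift hf measurable_const measurable_fst
    measurable_snd.fst _).add (measurable_snd.snd.const_smul (√(2 * η (k + 1) / β))))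
  have hgB : ∀ p, |g p| ≤ B := fun p => hB _
  calc ∫ ω, φ (sgldIterate f R β η S (W₀ ω) (fun k => I k ω) (fun k => ξ k ω) (k + 1)) ∂P
      = ∫ ω, g (w ω, I (k + 1) ω, ξ (k + 1) ω) ∂P := rfl
    _ = ∫ p, g p ∂(P.map fun ω => (w ω, I (k + 1) ω, ξ (k + 1) ω)) :=
      (integral_map (by fun_prop) hgm.aestronglyMeasurable).symm
    _ = ∫ v, ∫ q, g (v, q) ∂((uniformOn (Set.univ : Set (Fin n))).prod
          (stdGaussian (EuclideanSpace ℝ (Fin d)))) ∂(P.map w) := by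
      rw [hjoint, integral_prod _ (integrable_of_measurable_of_abs_le hgm hgB)]
    _ = ∫ ω, ∫ q, g (w ω, q) ∂((uniformOn (Set.univ : Set (Fin n))).prod
          (stdGaussian (EuclideanSpace ℝ (Fin d)))) ∂P :=
      integral_map (by fun_prop)
        hgm.stronglyMeasurable.integral_prod_right.aestronglyMeasurable
    _ = _ := by
      refine integral_congr_ae (.of_forall fun ω => ?_)
      exact integral_prod _ (integrable_of_measurable_of_abs_le
        (hgm.comp measurable_prodMk_left) fun q => hgB _)

end Randomness

/-! ### Stability of the law of the output under changing one example. -/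

section Stability

variable {d n : ℕ} {Z Ω : Type*} [MeasurableSpace Ω]
  {f : EuclideanSpace ℝ (Fin d) → Z → ℝ} {R : EuclideanSpace ℝ (Fin d) → ℝ}
  {P : Measure Ω} [IsProbabilityMeasure P] {σ₀ : ℝ}
  {W₀ : Ω → EuclideanSpace ℝ (Fin d)} {I : ℕ → Ω → Fin n}
  {ξ : ℕ → Ω → EuclideanSpace ℝ (Fin d)}

lemma integral_uniformOn_univ_fin (F : Fin n → ℝ) :
    ∫ j, F j ∂(uniformOn (Set.univ : Set (Fin n))) = (1 / (n : ℝ)) * ∑ j, F j := by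
  rw [uniformOn, ProbabilityTheory.cond, Measure.restrict_univ, integral_smul_measure, integral_count]
  simp

/-- Only the index `j₀`, of mass `1/n`, contributes. The regularizer cancels there, and the drifts
differ by at most `h L`. -/
lemma integral_norm_sgldDrift_sub_sq_le {L β h : ℝ} (hβ : 0 < β) (hh : 0 < h)
    (hL : ∀ w z z', ‖gradient (fun v => f v z) w - gradient (fun v => f v z') w‖ ≤ L)
    {S S' : Fin n → Z} {j₀ : Fin n} (hS : ∀ j ≠ j₀, S j = S' j) (w : EuclideanSpace ℝ (Fin d)) :
    ∫ j, ‖sgldDrift f R h S' w j - sgldDrift f R h S w j‖ ^ 2 / (2 * √(2 * h / β) ^ 2)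
      ∂(uniformOn (Set.univ : Set (Fin n))) ≤ β * L ^ 2 / (4 * n) * h := by
  have hn : (0 : ℝ) < n := by exact_mod_cast j₀.pos
  rw [integral_uniformOn_univ_fin, Finset.sum_eq_single j₀
    (fun j _ hj => by simp [sgldDrift, hS j hj]) (by simp), Real.sq_sqrt (by positivity)]
  have hnorm : ‖sgldDrift f R h S' w j₀ - sgldDrift f R h S w j₀‖ ≤ h * L := by
    have : sgldDrift f R h S' w j₀ - sgldDrift f R h S w j₀
        = h • (gradient (fun v => f v (S j₀)) w - gradient (fun v => f v (S' j₀)) w) := by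
      simp only [sgldDrift, smul_add, smul_sub]
      abel
    rw [this, norm_smul, Real.norm_of_nonneg hh.le]
    exact mul_le_mul_of_nonneg_left (hL _ _ _) hh.le
  calc 1 / (n : ℝ) * (‖sgldDrift f R h S' w j₀ - sgldDrift f R h S w j₀‖ ^ 2
        / (2 * (2 * h / β)))
      ≤ 1 / (n : ℝ) * ((h * L) ^ 2 / (2 * (2 * h / β))) := by gcongr
    _ = β * L ^ 2 / (4 * n) * h := by field_simp; ring

variable [MeasurableSpace Z]

/-- The dual (Donsker–Varadhan) form of the bound `KL(w_k(S) ‖ w_k(S')) ≤ β L² / (4 n) ∑ η` for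
datasets `S`, `S'` that differ in one position. -/
lemma IsSGLDRandomness.integral_le_log_integral_exp_sgldIterate
    (hrand : IsSGLDRandomness P σ₀ W₀ I ξ)
    (hf : Measurable fun p : EuclideanSpace ℝ (Fin d) × Z => gradient (fun w => f w p.2) p.1)
    {L β : ℝ} (hβ : 0 < β) {η : ℕ → ℝ} {N : ℕ} (hη : ∀ k ∈ Finset.Icc 1 N, 0 < η k)
    (hL : ∀ w z z', ‖gradient (fun v => f v z) w - gradient (fun v => f v z') w‖ ≤ L)
    {S S' : Fin n → Z} {j₀ : Fin n} (hS : ∀ j ≠ j₀, S j = S' j)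
    {φ : EuclideanSpace ℝ (Fin d) → ℝ} (hφ : Measurable φ) {B : ℝ} (hB : ∀ x, |φ x| ≤ B) :
    ∫ ω, φ (sgldIterate f R β η S (W₀ ω) (fun k => I k ω) (fun k => ξ k ω) N) ∂P
      ≤ Real.log (∫ ω, Real.exp (φ (sgldIterate f R β η S' (W₀ ω) (fun k => I k ω)
          (fun k => ξ k ω) N)) ∂P)
        + β * L ^ 2 / (4 * n) * ∑ k ∈ Finset.Icc 1 N, η k := by
  have hn : 0 < n := j₀.pos
  have : Nonempty (Fin n) := ⟨j₀⟩
  have : IsProbabilityMeasure (uniformOn (Set.univ : Set (Fin n))) :=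
    isProbabilityMeasure_uniformOn Set.finite_univ Set.univ_nonempty
  -- The test function must vary: the inductive hypothesis is applied to `ψ`, not to `φ`. At `N = 0`
  -- both runs have the same law and Jensen suffices.
  induction N generalizing φ with
  | zero =>
    have hm : Measurable fun ω => φ (W₀ ω) := hφ.comp hrand.measurable_init
    simpa [sgldIterate] using integral_le_log_integral_exp
      (integrable_of_measurable_of_abs_le (μ := P) hm fun ω => hB _)
      (integrable_exp_of_measurable_of_abs_le (μ := P) hm fun ω => hB _)
  | succ k ih =>
    have hh : 0 < η (k + 1) := hη _ (by simp)
    have hs : 0 < √(2 * η (k + 1) / β) := Real.sqrt_pos.2 (by positivity)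
    set s := √(2 * η (k + 1) / β)
    set U := uniformOn (Set.univ : Set (Fin n))
    set γ := stdGaussian (EuclideanSpace ℝ (Fin d))
    set a : EuclideanSpace ℝ (Fin d) → Fin n → EuclideanSpace ℝ (Fin d) :=
      sgldDrift f R (η (k + 1)) S
    set a' : EuclideanSpace ℝ (Fin d) → Fin n → EuclideanSpace ℝ (Fin d) :=
      sgldDrift f R (η (k + 1)) S'
    set w : Ω → EuclideanSpace ℝ (Fin d) := fun ω =>
      sgldIterate f R β η S (W₀ ω) (fun k => I k ω) (fun k => ξ k ω) k
    set w' : Ω → EuclideanSpace ℝ (Fin d) := fun ω =>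
      sgldIterate f R β η S' (W₀ ω) (fun k => I k ω) (fun k => ξ k ω) k
    have hwm : Measurable w := hrand.measurable_sgldIterate hf β η S k
    have ham : Measurable fun p : EuclideanSpace ℝ (Fin d) × Fin n => a p.1 p.2 :=
      Measurable.sgldDrift hf measurable_const measurable_fst measurable_snd _
    have ha'm : Measurable fun p : EuclideanSpace ℝ (Fin d) × Fin n => a' p.1 p.2 :=
      Measurable.sgldDrift hf measurable_const measurable_fst measurable_snd _
    let Φ : EuclideanSpace ℝ (Fin d) → ℝ := fun v => ∫ j, ∫ x, φ (a v j + s • x) ∂γ ∂U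
    let Ψ : EuclideanSpace ℝ (Fin d) → ℝ := fun v =>
      ∫ j, ∫ x, Real.exp (φ (a' v j + s • x)) ∂γ ∂U
    -- The log-Laplace transform of `φ` under one step on `S'`, chosen so that averaging `exp ψ`
    -- over `w'` gives exactly the exponential moment of `φ` one step later.
    let ψ : EuclideanSpace ℝ (Fin d) → ℝ := fun v => Real.log (Ψ v)
    have hΦm : Measurable Φ := by
      have h1 : Measurable fun p : (EuclideanSpace ℝ (Fin d) × Fin n) ×
          EuclideanSpace ℝ (Fin d) => φ (a p.1.1 p.1.2 + s • p.2) :=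
        hφ.comp ((ham.comp measurable_fst).add (measurable_snd.const_smul s))
      exact h1.stronglyMeasurable.integral_prod_right.integral_prod_right.measurable
    have hΨm : Measurable Ψ := by
      have h1 : Measurable fun p : (EuclideanSpace ℝ (Fin d) × Fin n) ×
          EuclideanSpace ℝ (Fin d) => Real.exp (φ (a' p.1.1 p.1.2 + s • p.2)) :=
        (hφ.comp ((ha'm.comp measurable_fst).add (measurable_snd.const_smul s))).exp
      exact h1.stronglyMeasurable.integral_prod_right.integral_prod_right.measurable
    have hψm : Measurable ψ := hΨm.log
    have hshift : ∀ b : EuclideanSpace ℝ (Fin d), Measurable fun x => φ (b + s • x) :=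
      fun b => by fun_prop
    -- Inserting `exp ∘ log` shows `Ψ` as an exponential moment over the index alone, ready for
    -- Jensen over `U`.
    have hΨeq : ∀ v, Ψ v
        = ∫ j, Real.exp (Real.log (∫ x, Real.exp (φ (a' v j + s • x)) ∂γ)) ∂U := by
      intro v
      refine integral_congr_ae (.of_forall fun j => (Real.exp_log ?_).symm)
      exact integral_exp_pos (integrable_exp_of_measurable_of_abs_le (hshift _) fun x => hB _)
    have hψB : ∀ v, |ψ v| ≤ B := by
      intro v
      simp only [ψ, hΨeq]
      exact abs_log_integral_exp_le (measurable_of_countable _) fun j =>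
        abs_log_integral_exp_le (hshift _) fun x => hB _
    have hΨpos : ∀ v, 0 < Ψ v := by
      intro v
      rw [hΨeq]
      exact integral_exp_pos (integrable_exp_of_measurable_of_abs_le (measurable_of_countable _)
        fun j => abs_log_integral_exp_le (hshift _) fun x => hB _)
    have hΦB : ∀ v, |Φ v| ≤ B := by
      have habs : ∀ {α : Type} [MeasurableSpace α] (μ : Measure α) [IsProbabilityMeasure μ]
          (g : α → ℝ), (∀ x, |g x| ≤ B) → |∫ x, g x ∂μ| ≤ B := fun μ _ g hg => by
        simpa using norm_integral_le_of_norm_le_const (μ := μ) (f := g) (.of_forall hg)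
      exact fun v => habs U _ fun j => habs γ _ fun x => hB _
    -- The Gaussian bound is applied for each index separately with the same index in both runs;
    -- Jensen over the index then moves the average inside the logarithm.
    have hstep : ∀ v, Φ v ≤ ψ v + β * L ^ 2 / (4 * n) * η (k + 1) := by
      intro v
      have h1 : Φ v ≤ ∫ j, (Real.log (∫ x, Real.exp (φ (a' v j + s • x)) ∂γ)
          + ‖a' v j - a v j‖ ^ 2 / (2 * s ^ 2)) ∂U :=
        integral_mono .of_finite .of_finite fun j =>
          integral_gaussian_le_log_integral_exp hφ hB _ _ hs
      rw [integral_add .of_finite .of_finite] at h1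
      have h2 := integral_norm_sgldDrift_sub_sq_le (R := R) hβ hh hL hS v
      have h3 := integral_le_log_integral_exp (μ := U)
        (g := fun j => Real.log (∫ x, Real.exp (φ (a' v j + s • x)) ∂γ)) .of_finite .of_finite
      rw [← hΨeq] at h3
      linarith
    have hexpφ : ∫ ω, Real.exp (φ (sgldIterate f R β η S' (W₀ ω) (fun k => I k ω)
        (fun k => ξ k ω) (k + 1))) ∂P = ∫ ω, Real.exp (ψ (w' ω)) ∂P := by
      rw [hrand.integral_sgldIterate_succ hn hf β η S' k (φ := fun v => Real.exp (φ v))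
        (by fun_prop) (B := Real.exp B) fun x => by
          rw [Real.abs_exp]
          exact Real.exp_le_exp.2 ((le_abs_self _).trans (hB x))]
      exact integral_congr_ae (.of_forall fun ω => (Real.exp_log (hΨpos _)).symm)
    have hih := ih (fun j hj => hη j (Finset.Icc_subset_Icc_right (by omega) hj)) hψm hψB
    rw [hrand.integral_sgldIterate_succ hn hf β η S k hφ hB, hexpφ,
      Finset.sum_Icc_succ_top (by omega), mul_add]
    have hmono : ∫ ω, Φ (w ω) ∂P ≤ ∫ ω, (ψ (w ω) + β * L ^ 2 / (4 * n) * η (k + 1)) ∂P :=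
      integral_mono
        (integrable_of_measurable_of_abs_le (hΦm.comp hwm) fun ω => hΦB _)
        ((integrable_of_measurable_of_abs_le (hψm.comp hwm) fun ω => hψB _).add
          (integrable_const _)) fun ω => hstep _
    rw [integral_add (f := fun ω => ψ (w ω))
      (integrable_of_measurable_of_abs_le (hψm.comp hwm) fun ω => hψB _)
      (integrable_const _), integral_const] at hmono
    simp only [probReal_univ, one_smul] at hmono
    change ∫ ω, Φ (w ω) ∂P ≤ _
    linarith

/-- Every multiple `t * g` is a bounded test function, so the dual entropy bound feeds the
Pinsker-type inequality for the two laws of the output. -/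
lemma IsSGLDRandomness.integral_sub_integral_sgldIterate_le
    (hrand : IsSGLDRandomness P σ₀ W₀ I ξ)
    (hf : Measurable fun p : EuclideanSpace ℝ (Fin d) × Z => gradient (fun w => f w p.2) p.1)
    {L β : ℝ} (hβ : 0 < β) {η : ℕ → ℝ} {N : ℕ} (hη : ∀ k ∈ Finset.Icc 1 N, 0 < η k)
    (hL : ∀ w z z', ‖gradient (fun v => f v z) w - gradient (fun v => f v z') w‖ ≤ L)
    {S S' : Fin n → Z} {j₀ : Fin n} (hS : ∀ j ≠ j₀, S j = S' j)
    {g : EuclideanSpace ℝ (Fin d) → ℝ} (hg : Measurable g) {C : ℝ}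
    (hg0 : ∀ x, 0 ≤ g x) (hgC : ∀ x, g x ≤ C) :
    ∫ ω, g (sgldIterate f R β η S (W₀ ω) (fun k => I k ω) (fun k => ξ k ω) N) ∂P
      - ∫ ω, g (sgldIterate f R β η S' (W₀ ω) (fun k => I k ω) (fun k => ξ k ω) N) ∂P
      ≤ L * C * √(β / (8 * n) * ∑ k ∈ Finset.Icc 1 N, η k) := by
  have hL0 : 0 ≤ L := (norm_nonneg _).trans (hL 0 (S j₀) (S j₀))
  have hC : 0 ≤ C := (hg0 0).trans (hgC 0)
  have hwm := fun S => hrand.measurable_sgldIterate (R := R) hf β η S N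
  have hmap : ∀ (S : Fin n → Z) {φ : EuclideanSpace ℝ (Fin d) → ℝ}, Measurable φ →
      ∫ ω, φ (sgldIterate f R β η S (W₀ ω) (fun k => I k ω) (fun k => ξ k ω) N) ∂P
        = ∫ v, φ v ∂(P.map fun ω =>
          sgldIterate f R β η S (W₀ ω) (fun k => I k ω) (fun k => ξ k ω) N) :=
    fun S φ hφ => (integral_map (hwm S).aemeasurable hφ.aestronglyMeasurable).symm
  have := Measure.isProbabilityMeasure_map (μ := P) (hwm S').aemeasurable
  rw [hmap S hg, hmap S' hg]
  refine (integral_sub_integral_le_of_forall_mul_le hg (C := C)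
    (K := β * L ^ 2 / (4 * n) * ∑ k ∈ Finset.Icc 1 N, η k) hC hg0 hgC fun t => ?_).trans_eq ?_
  · rw [← hmap S (φ := fun v => t * g v) (by fun_prop),
      ← hmap S' (φ := fun v => Real.exp (t * g v)) (by fun_prop)]
    refine hrand.integral_le_log_integral_exp_sgldIterate hf hβ hη hL hS
      (φ := fun v => t * g v) (by fun_prop) (B := |t| * C) fun x => ?_
    rw [abs_mul, abs_of_nonneg (hg0 x)]
    exact mul_le_mul_of_nonneg_left (hgC x) (abs_nonneg _)
  · have : β * L ^ 2 / (4 * n) * (∑ k ∈ Finset.Icc 1 N, η k) / 2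
        = L ^ 2 * (β / (8 * n) * ∑ k ∈ Finset.Icc 1 N, η k) := by ring
    rw [this, Real.sqrt_mul (by positivity), Real.sqrt_sq hL0]
    ring

end Stability

/-! ### From stability to generalization by exchanging examples. -/

section Resampling

variable {m : ℕ} {Z : Type*} [MeasurableSpace Z]

lemma measurable_insertNth (j : Fin (m + 1)) :
    Measurable fun p : Z × (Fin m → Z) => (j.insertNth p.1 p.2 : Fin (m + 1) → Z) :=
  (MeasurableEquiv.piFinSuccAbove (fun _ : Fin (m + 1) => Z) j).symm.measurable

lemma integral_pi_eq_integral_insertNth (D : Measure Z) [IsProbabilityMeasure D]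
    (j : Fin (m + 1)) {G : (Fin (m + 1) → Z) → ℝ} (hG : Measurable G) {B : ℝ}
    (hB : ∀ S, |G S| ≤ B) :
    ∫ S, G S ∂(Measure.pi fun _ => D)
      = ∫ s, ∫ a, G (j.insertNth a s) ∂D ∂(Measure.pi fun _ : Fin m => D) := by
  rw [← ((measurePreserving_piFinSuccAbove (fun _ : Fin (m + 1) => D) j).symm).integral_comp' G]
  exact integral_prod_symm _ (integrable_of_measurable_of_abs_le
    (hG.comp (measurable_insertNth j)) fun p => hB _)

/-- Resampling the `j`-th example bounds the gap between a fresh test point and a training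
point. -/
lemma integral_integral_sub_integral_eval_le (D : Measure Z) [IsProbabilityMeasure D]
    {n : ℕ} (j : Fin n) {A : (Fin n → Z) → Z → ℝ}
    (hA : Measurable fun p : (Fin n → Z) × Z => A p.1 p.2) {B K : ℝ} (hB : ∀ S z, |A S z| ≤ B)
    (hK : ∀ S S' : Fin n → Z, (∀ i ≠ j, S i = S' i) → ∀ z, A S z - A S' z ≤ K) :
    ∫ S, ∫ z, A S z ∂D ∂(Measure.pi fun _ => D) - ∫ S, A S (S j) ∂(Measure.pi fun _ => D)
      ≤ K := by
  obtain ⟨m, rfl⟩ : ∃ m, n = m + 1 := ⟨n - 1, by have := j.pos; omega⟩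
  have hAS : Measurable fun S : Fin (m + 1) → Z => ∫ z, A S z ∂D :=
    hA.stronglyMeasurable.integral_prod_right.measurable
  have hASB : ∀ S, |∫ z, A S z ∂D| ≤ B := fun S => by
    simpa using norm_integral_le_of_norm_le_const (μ := D) (f := A S) (.of_forall (hB S))
  have hAj : Measurable fun S : Fin (m + 1) → Z => A S (S j) :=
    hA.comp (measurable_id.prodMk (measurable_pi_apply j))
  have hins := measurable_insertNth (Z := Z) j
  rw [integral_pi_eq_integral_insertNth D j hAS hASB,
    integral_pi_eq_integral_insertNth D j hAj fun S => hB _ _]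
  simp only [Fin.insertNth_apply_same]
  have hins' : ∀ s : Fin m → Z, Measurable fun a : Z => (j.insertNth a s : Fin (m + 1) → Z) :=
    fun s => hins.comp measurable_prodMk_right
  have hm1 : Measurable fun s : Fin m → Z => ∫ a, ∫ z, A (j.insertNth a s) z ∂D ∂D := by
    have : Measurable fun p : (Fin m → Z) × Z => ∫ z, A (j.insertNth p.2 p.1) z ∂D :=
      hAS.comp (hins.comp measurable_swap)
    exact this.stronglyMeasurable.integral_prod_right.measurable
  have hm2 : Measurable fun s : Fin m → Z => ∫ a, A (j.insertNth a s) a ∂D := by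
    have : Measurable fun p : (Fin m → Z) × Z => A (j.insertNth p.2 p.1) p.2 :=
      hA.comp ((hins.comp measurable_swap).prodMk measurable_snd)
    exact this.stronglyMeasurable.integral_prod_right.measurable
  have habs : ∀ g : Z → ℝ, (∀ z, |g z| ≤ B) → |∫ z, g z ∂D| ≤ B := fun g hg => by
    simpa using norm_integral_le_of_norm_le_const (μ := D) (f := g) (.of_forall hg)
  rw [← integral_sub (integrable_of_measurable_of_abs_le hm1 fun s => habs _ fun a => hASB _)
    (integrable_of_measurable_of_abs_le hm2 fun s => habs _ fun a => hB _ _)]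
  have hpt : ∀ s : Fin m → Z, ∫ a, ∫ z, A (j.insertNth a s) z ∂D ∂D
      - ∫ a, A (j.insertNth a s) a ∂D ≤ K := by
    intro s
    have hswap : Measurable fun p : Z × Z => A (j.insertNth p.1 s) p.2 :=
      hA.comp (((hins' s).comp measurable_fst).prodMk measurable_snd)
    have hswap' : Measurable fun p : Z × Z => A (j.insertNth p.2 s) p.1 :=
      hswap.comp measurable_swap
    have hdiag : Measurable fun a : Z => A (j.insertNth a s) a :=
      hA.comp ((hins' s).prodMk measurable_id)
    have hi1 : Integrable (fun a => ∫ z, A (j.insertNth z s) a ∂D) D :=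
      integrable_of_measurable_of_abs_le
        hswap'.stronglyMeasurable.integral_prod_right.measurable fun a => habs _ fun z => hB _ _
    have hi2 : Integrable (fun a => A (j.insertNth a s) a) D :=
      integrable_of_measurable_of_abs_le hdiag fun a => hB _ _
    -- Test point and `j`-th example are both independent draws from `D`. After the swap the outer
    -- variable is the test point in both terms, and the two datasets differ only in position `j`.
    rw [integral_integral_swap (f := fun a z => A (j.insertNth a s) z)
      (integrable_of_measurable_of_abs_le hswap fun p => hB _ _), ← integral_sub hi1 hi2]
    have hle : ∀ a, ∫ z, A (j.insertNth z s) a ∂D - A (j.insertNth a s) a ≤ K := by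
      intro a
      have hi : Integrable (fun z => A (j.insertNth z s) a) D :=
        integrable_of_measurable_of_abs_le (hA.comp ((hins' s).prodMk measurable_const))
          fun z => hB _ _
      have h1 := integral_mono hi (integrable_const (K + A (j.insertNth a s) a)) fun z => by
        have := hK (j.insertNth z s) (j.insertNth a s) (fun i hi => by
          obtain ⟨i', rfl⟩ := Fin.exists_succAbove_eq hi
          simp) a
        simp only
        linarith
      simp only [integral_const, probReal_univ, one_smul] at h1
      linarith
    simpa using integral_mono (hi1.sub hi2) (integrable_const K) hle
  simpa using integral_mono (μ := Measure.pi fun _ : Fin m => D)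
    ((integrable_of_measurable_of_abs_le hm1 fun s => habs _ fun a => hASB _).sub
      (integrable_of_measurable_of_abs_le hm2 fun s => habs _ fun a => hB _ _))
    (integrable_const K) hpt

end Resampling

/-! ### The generalization bound. -/

theorem theorem6 {d n N : ℕ} (hn : 0 < n)
    {Z : Type*} [MeasurableSpace Z] (D : Measure Z) [IsProbabilityMeasure D]
    {Ω : Type*} [MeasurableSpace Ω] (P : Measure Ω) [IsProbabilityMeasure P]
    (f : EuclideanSpace ℝ (Fin d) → Z → ℝ) (R : EuclideanSpace ℝ (Fin d) → ℝ)
    (ℓ : EuclideanSpace ℝ (Fin d) → Z → ℝ)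
    (β σ₀ L C : ℝ) (hβ : 0 < β) (hσ₀ : 0 < σ₀)
    (η : ℕ → ℝ) (hη : ∀ k ∈ Finset.Icc 1 N, 0 < η k)
    (hf : ∀ z, Differentiable ℝ (fun w => f w z)) (hR : Differentiable ℝ R)
    (hf_meas : Measurable fun p : EuclideanSpace ℝ (Fin d) × Z =>
      gradient (fun w => f w p.2) p.1)
    (hℓ_meas : Measurable fun p : EuclideanSpace ℝ (Fin d) × Z => ℓ p.1 p.2)
    (hℓ : ∀ w z, 0 ≤ ℓ w z ∧ ℓ w z ≤ C)
    (hL : ∀ w z z', ‖gradient (fun v => f v z) w - gradient (fun v => f v z') w‖ ≤ L)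
    (W₀ : Ω → EuclideanSpace ℝ (Fin d)) (I : ℕ → Ω → Fin n)
    (ξ : ℕ → Ω → EuclideanSpace ℝ (Fin d))
    (hrand : IsSGLDRandomness P σ₀ W₀ I ξ) :
    ∫ S : Fin n → Z,
        genErr ℓ D P S
          (fun ω => sgldIterate f R β η S (W₀ ω) (fun k => I k ω) (fun k => ξ k ω) N)
      ∂(Measure.pi fun _ : Fin n => D)
      ≤ L * C * √(β / (8 * n) * ∑ k ∈ Finset.Icc 1 N, η k) := by
  have hn' : (n : ℝ) ≠ 0 := by exact_mod_cast hn.ne'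
  set K := L * C * √(β / (8 * n) * ∑ k ∈ Finset.Icc 1 N, η k)
  set w : (Fin n → Z) → Ω → EuclideanSpace ℝ (Fin d) := fun S ω =>
    sgldIterate f R β η S (W₀ ω) (fun k => I k ω) (fun k => ξ k ω) N
  have hwm : Measurable fun p : (Fin n → Z) × Ω => w p.1 p.2 :=
    Measurable.sgldIterate hf_meas measurable_fst (hrand.measurable_init.comp measurable_snd)
      (fun k => (hrand.measurable_index k).comp measurable_snd)
      (fun k => (hrand.measurable_noise k).comp measurable_snd) β η N
  have hℓC : ∀ v z, |ℓ v z| ≤ C := fun v z => by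
    rw [abs_of_nonneg (hℓ v z).1]
    exact (hℓ v z).2
  let A : (Fin n → Z) → Z → ℝ := fun S z => ∫ ω, ℓ (w S ω) z ∂P
  have hA : Measurable fun p : (Fin n → Z) × Z => A p.1 p.2 := by
    have : Measurable fun p : ((Fin n → Z) × Z) × Ω => ℓ (w p.1.1 p.2) p.1.2 :=
      hℓ_meas.comp ((hwm.comp (measurable_fst.fst.prodMk measurable_snd)).prodMk
        measurable_fst.snd)
    exact this.stronglyMeasurable.integral_prod_right.measurable
  have hAC : ∀ S z, |A S z| ≤ C := fun S z => by
    simpa using norm_integral_le_of_norm_le_const (μ := P) (f := fun ω => ℓ (w S ω) z)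
      (.of_forall fun ω => hℓC _ _)
  -- Fubini moves the algorithm's randomness innermost, so the error depends only on the expected
  -- loss `A S z` at a point.
  have hgen : ∀ S, genErr ℓ D P S (w S)
      = (∫ z, A S z ∂D) - (1 / (n : ℝ)) * ∑ j, A S (S j) := by
    intro S
    have hwS : Measurable (w S) := hwm.comp measurable_prodMk_left
    have hm : Measurable fun p : Ω × Z => ℓ (w S p.1) p.2 :=
      hℓ_meas.comp ((hwS.comp measurable_fst).prodMk measurable_snd)
    have hi : ∀ j, Integrable (fun ω => ℓ (w S ω) (S j)) P := fun j =>
      integrable_of_measurable_of_abs_le (hm.comp measurable_prodMk_right) fun ω => hℓC _ _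
    have hprod : Integrable (fun p : Ω × Z => ℓ (w S p.1) p.2) (P.prod D) :=
      integrable_of_measurable_of_abs_le hm fun p => hℓC _ _
    rw [genErr, integral_sub hprod.integral_prod_left
      ((integrable_finsetSum _ fun j _ => hi j).const_mul _), integral_const_mul,
      integral_finsetSum _ fun j _ => hi j,
      integral_integral_swap (f := fun ω z => ℓ (w S ω) z) hprod]
  have hi1 : Integrable (fun S => ∫ z, A S z ∂D) (Measure.pi fun _ : Fin n => D) :=
    integrable_of_measurable_of_abs_le hA.stronglyMeasurable.integral_prod_right.measurable
      (B := C) fun S => by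
        simpa using norm_integral_le_of_norm_le_const (μ := D) (f := A S)
          (.of_forall (hAC S))
  have hi2 : ∀ j, Integrable (fun S => A S (S j)) (Measure.pi fun _ : Fin n => D) := fun j =>
    integrable_of_measurable_of_abs_le
      (hA.comp (measurable_id.prodMk (measurable_pi_apply j))) fun S => hAC _ _
  have hj : ∀ j : Fin n, ∫ S, ∫ z, A S z ∂D ∂(Measure.pi fun _ => D)
      - ∫ S, A S (S j) ∂(Measure.pi fun _ => D) ≤ K := fun j =>
    integral_integral_sub_integral_eval_le D j hA hAC fun S S' hS z =>
      hrand.integral_sub_integral_sgldIterate_le hf_meas hβ hη hL hS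
        (g := fun v => ℓ v z) (hℓ_meas.comp measurable_prodMk_right)
        (fun v => (hℓ v z).1) fun v => (hℓ v z).2
  calc ∫ S, genErr ℓ D P S (w S) ∂(Measure.pi fun _ => D)
      = (∫ S, ∫ z, A S z ∂D ∂(Measure.pi fun _ => D))
        - (1 / (n : ℝ)) * ∑ j, ∫ S, A S (S j) ∂(Measure.pi fun _ => D) := by
        simp_rw [hgen]
        rw [integral_sub hi1 ((integrable_finsetSum _ fun j _ => hi2 j).const_mul _),
          integral_const_mul, integral_finsetSum _ fun j _ => hi2 j]
    -- The population term is spread evenly over the `n` positions, so each training point is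
    -- compared with its own resampled copy.
    _ = (1 / (n : ℝ)) * ∑ j : Fin n, (∫ S, ∫ z, A S z ∂D ∂(Measure.pi fun _ => D)
        - ∫ S, A S (S j) ∂(Measure.pi fun _ => D)) := by
        rw [Finset.sum_sub_distrib]
        simp
        field_simp
    _ ≤ (1 / (n : ℝ)) * ∑ _j : Fin n, K := by
        gcongr with j
        exact hj j
    _ = K := by simp; field_simp
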